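/- Let $\mathbb{Z}_2$ denote the ring of 2-adic integers. Let $n=8m-1$ be prime and let $Q$ be the set of nonzero quadratic residues modulo $n$. Let $g\in\mathbb{Z}_2[X]$ be the generator polynomial of a 2-adic quadratic residue code of length $n$: a monic divisor of $X^n-1$ over $\mathbb{Z}_2$ whose reduction modulo $2$ is the generator polynomial $\prod_{r\in Q}(X-\alpha^r)$ of a binary quadratic residue code, where $\alpha$ is a primitive $n$-th root of unity in an algebraic closure of $\mathbb{F}_2$. Let $C$ be the cyclic code of length $n$ over $\mathbb{Z}_2$ generated by $g$, i.e. the ideal $(g)$ of $\mathbb{Z}_2[X]/(X^n-1)$; let $e$ be its idempotent generator and let $\theta\in\mathbb{Z}_2$ be a square root of $-1/n$. The extended code $\widehat C\subseteq\mathbb{Z}_2^{n+1}$ is the $\mathbb{Z}_2$-submodule generated by the words $(X^ie,\theta)$, $0\le i<n$, i.e. the $n$ cyclic shifts of $e$ with $\theta$ appended to each. Then $\widehat C$ is self-dual, its minimal Hamming distance is $(n+3)/2$, and it is MDS. Here a code of length $N$, rank $k$ and minimal Hamming distance $d$ is MDS if $d=N-k+1$ or, equivalently, if any $k$ columns of a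 generator matrix with $k$ rows are linearly independent over $\mathbb{Z}_2$; both properties are asserted. In particular: (a) The equation $\lambda^2-\lambda+2=0$ has a root in $\mathbb{Z}_2$, and for each root $\lambda$ the 2-adic Hamming code of length $8$, generated by the four shifts of $(1,\lambda,\lambda-1,-1,0,0,0)$ inside length $7$, each extended by an eighth coordinate $1$, has minimal Hamming distance $5$ and is MDS. (b) The equation $\nu^2-\nu+6=0$ has a root in $\mathbb{Z}_2$, and for each root $\nu$ the 2-adic Golay code of length $24$, generated by the twelve shifts inside length $23$ of the vector of coefficients of $$X^{11}+\nu X^{10}+(\nu-3)X^9-4X^8-(\nu+3)X^7-(2\nu+1)X^6-(2\nu-3)X^5-(\nu-4)X^4+4X^3+(\nu+2)X^2+(\nu-1)X-1$$ (highest degree first), each extended by a twenty-fourth coordinate $1$, has minimal Hamming distance $13$ and is MDS. -/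

import Mathlib

open Polynomial

noncomputable section

namespace AdicCode

section General

variable {R : Type*} [CommRing R] {ι : Type*} [Fintype ι]

open Classical in
/-- `d` is the minimal Hamming distance between distinct codewords of `C`. -/
def IsMinHammingDist (C : Submodule R (ι → R)) (d : ℕ) : Prop :=
  IsLeast {t : ℕ | ∃ x ∈ C, ∃ y ∈ C, x ≠ y ∧ hammingDist x y = t} d

/-- `C` equals its dual code for the inner product `v ⬝ w = ∑ i, v i * w i`. -/
def IsSelfDual (C : Submodule R (ι → R)) : Prop :=
  ∀ v : ι → R, v ∈ C ↔ ∀ w ∈ C, v ⬝ᵥ w = 0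

/-- Equality in the Singleton bound `d ≤ N - k + 1`, where `N` is the length of the code and
`k` its rank (the number of rows of a generator matrix). -/
def IsMDS (C : Submodule R (ι → R)) : Prop :=
  ∃ d : ℕ, IsMinHammingDist C d ∧ d + Module.finrank R C = Fintype.card ι + 1

/-- `G` is a generator matrix of `C`, with as many rows as the rank of `C`. -/
def IsGeneratorMatrix (C : Submodule R (ι → R))
    (G : Matrix (Fin (Module.finrank R C)) ι R) : Prop :=
  Submodule.span R (Set.range G.row) = C

/-- Any `k` columns of a generator matrix are linearly independent, `k` being the rank. -/
def ColumnsIndependent (C : Submodule R (ι → R)) : Prop :=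
  ∀ G : Matrix (Fin (Module.finrank R C)) ι R, IsGeneratorMatrix C G →
    ∀ S : Finset ι, S.card = Module.finrank R C →
      LinearIndependent R (fun j : S => fun i => G i j)

/-- Append the entry `x`, in the position `∞` (written `none`), to a word `c`. -/
def append {κ : Type*} (c : κ → R) (x : R) : Option κ → R
  | some j => c j
  | none => x

end General

section Cyclic

variable {R : Type*} [CommRing R] (n : ℕ) [NeZero n]

/-- The polynomial `c₀ + c₁ X + ⋯ + cₙ₋₁ Xⁿ⁻¹` of a word `c`. -/
def wordPoly : (ZMod n → R) →ₗ[R] R[X] :=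
  ∑ j : ZMod n, (Polynomial.monomial j.val) ∘ₗ (LinearMap.proj j)

/-- The cyclic code of length `n` generated by `g`: the words whose polynomial lies in the ideal
generated by `g` in `R[X] / (Xⁿ - 1)`. -/
def cyclicCode (g : R[X]) : Submodule R (ZMod n → R) :=
  ((Ideal.span {g, X ^ n - 1}).restrictScalars R).comap (wordPoly n)

/-- `e` is an idempotent of `R[X] / (Xⁿ - 1)` that generates the cyclic code `C`. -/
def IsIdempotentGenerator (C : Submodule R (ZMod n → R)) (e : ZMod n → R) : Prop :=
  (X ^ n - 1 : R[X]) ∣ wordPoly n e ^ 2 - wordPoly n e ∧ cyclicCode n (wordPoly n e) = C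

/-- The code of length `n + 1` obtained from the cyclic code `C` by appending `x` to each of its
generators, namely to all cyclic shifts of its generating idempotent. -/
def extendedCode (C : Submodule R (ZMod n → R)) (x : R) : Submodule R (Option (ZMod n) → R) :=
  Submodule.span R {w | ∃ e : ZMod n → R, IsIdempotentGenerator n C e ∧
    ∃ i : ZMod n, w = append (fun j => e (j - i)) x}

open Classical in
/-- The nonzero quadratic residues modulo `n`. -/
def residues : Finset (ZMod n) :=
  Finset.univ.filter fun r => r ≠ 0 ∧ IsSquare r

/-- `g` is the 2-adic lift of the generator polynomial `∏ (X - α ^ r)`, with `r` running over the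
nonzero quadratic residues modulo `n`, of a binary quadratic residue code of length `n`: it is a
monic divisor of `Xⁿ - 1` over the 2-adic integers that reduces to that polynomial modulo 2. Here
`α` is any primitive `n`-th root of unity in characteristic 2. -/
def IsQRGenerator (g : ℤ_[2][X]) : Prop :=
  g.Monic ∧ g ∣ X ^ n - 1 ∧
    ∃ α : AlgebraicClosure (ZMod 2), IsPrimitiveRoot α n ∧
      g.map ((algebraMap (ZMod 2) (AlgebraicClosure (ZMod 2))).comp PadicInt.toZMod) =
        ∏ r ∈ residues n, (X - C (α ^ r.val))

end Cyclic

section Examples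

variable {R : Type*} [CommRing R]

/-- The matrix with `k` rows and `2 k` columns whose rows are the `k` shifts of
`a₀ a₁ … aₖ₋₁ 0 … 0` (of length `2 k - 1`), followed by an entry `1` in the position `∞`. -/
def shiftMatrix {k : ℕ} (a : Fin k → R) : Matrix (Fin k) (Option (Fin (2 * k - 1))) R :=
  Matrix.of fun i => append
    (fun j => if h : (i : ℕ) ≤ j ∧ (j : ℕ) - i < k then a ⟨j - i, h.2⟩ else 0) 1

/-- The code generated by the rows of `shiftMatrix a`. -/
def shiftCode {k : ℕ} (a : Fin k → R) : Submodule R (Option (Fin (2 * k - 1)) → R) :=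
  Submodule.span R (Set.range (shiftMatrix a).row)

/-- The 2-adic Hamming code of length 8, with generating vector the coefficients of
`X³ + l X² + (l - 1) X - 1`, where `l² - l + 2 = 0`. -/
def hammingCode (l : ℤ_[2]) : Submodule ℤ_[2] (Option (Fin 7) → ℤ_[2]) :=
  shiftCode ![1, l, l - 1, -1]

/-- The 2-adic Golay code of length 24, where `v² - v + 6 = 0`; the entries are the coefficients
of the generator polynomial, from degree 11 down to degree 0. -/
def golayCode (v : ℤ_[2]) : Submodule ℤ_[2] (Option (Fin 23) → ℤ_[2]) :=
  shiftCode ![1, v, v - 3, -4, -(v + 3), -(2 * v + 1), -(2 * v - 3), -(v - 4), 4, v + 2, v - 1, -1]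

end Examples

end AdicCode

end

/-!
Extending a cyclic code of prime length `n` over the 2-adic integers appends a fixed multiple of the
value `c(1)` to each codeword, viewed as a polynomial `c`. The distance is governed by Chebotarev's
theorem on roots of unity, in the form `card_lt_card_support_of_roots_of_unity`: in characteristic
zero, a nonzero polynomial of degree less than a prime `n` has more terms than it has `n`-th roots of
unity among its roots. It follows from the corresponding fact about the order of vanishing at `1` in
characteristic `n`, by reduction modulo the prime `ζ - 1` of the `n`-th cyclotomic field.

Let `g` divide `X ^ n - 1`, have degree `k - 1` with `n + 1 = 2 * k`, and not vanish at `1`. A nonzero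
codeword `b * g` vanishes at the `k - 1` roots of `g`, so it has at least `k` terms; if its value at
`1` is zero then it has one root more, hence at least `k + 1` terms; otherwise the appended coordinate
is nonzero. In both cases the extended word has weight at least `k + 1`
(`lt_hammingNorm_encode`), the value of the Singleton bound, and `g` itself attains it. Independence
of any `k` columns of a generator matrix is the usual reformulation (`columnsIndependent_of_isMDS`).
The Hamming and Golay codes are instances, since their generating polynomials are explicit divisors
of `X ^ 7 - 1` and `X ^ 23 - 1`.

For the quadratic residue codes, the idempotent generator takes the value `1` at `1`, which gives a
description of the extended code without idempotents (`mem_extendedCode`). For `n ≡ 3 mod 4`, `-1` is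
not a square modulo `n`, so no root of `g` is the inverse of a root: this holds modulo `2` and lifts
because a resultant that is a unit modulo `2` is a unit. Counting, every `n`-th root of unity other
than `1` is a root of `g` or the inverse of one. In Parseval's identity for two codewords `c` and `d`,
only the term `c(1) * d(1)` survives, and it cancels against the product of the appended
coordinates because `n * θ ^ 2 = -1`. Conversely, the Fourier transform of the orthogonality of a word
to all extended shifts of `g` forces that word into the extended code.
-/

noncomputable section

namespace AdicCode

/-! ### Chebotarev's theorem on roots of unity -/

/-- Differentiating a polynomial with nonzero constant term removes one term and lowers the order of
vanishing at `1` by one; in degree less than the characteristic no other term is lost. -/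
theorem lt_card_support_of_X_sub_one_pow_dvd {F : Type*} [CommRing F] [IsDomain F] {p : ℕ}
    [Fact p.Prime] [CharP F p] (k : ℕ) : ∀ {f : F[X]}, f ≠ 0 → f.natDegree < p →
      (X - 1) ^ k ∣ f → k < f.support.card := by
  induction k with
  | zero => intro f hf _ _; simpa [Finset.card_pos] using hf
  | succ k ih =>
    intro f hf hdeg hdvd
    obtain ⟨q, hq⟩ := hdvd
    -- a factor `X ^ m` does not change the number of terms, so `f 0 ≠ 0` may be assumed
    obtain ⟨h, hfh, hh⟩ := exists_eq_pow_rootMultiplicity_mul_and_not_dvd f hf 0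
    set m := f.rootMultiplicity 0
    rw [C_0, sub_zero] at hfh hh
    have hh0 : h.coeff 0 ≠ 0 := fun h0 => hh (X_dvd_iff.2 h0)
    have hne : h ≠ 0 := by rintro rfl; simp at hh
    have hcard : f.support.card = h.support.card := by
      rw [hfh, mul_comm, ← Finset.card_map (addRightEmbedding m) (s := h.support)]
      congr 1
      ext i
      simp only [mem_support_iff, coeff_mul_X_pow', Finset.mem_map, addRightEmbedding_apply]
      constructor
      · intro hi
        split_ifs at hi with hmi
        · exact ⟨i - m, hi, by omega⟩
        · exact absurd rfl hi
      · rintro ⟨j, hj, rfl⟩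
        simpa using hj
    have hdh : h.natDegree < p := by
      have : f.natDegree = m + h.natDegree := by
        conv_lhs => rw [hfh, natDegree_mul (pow_ne_zero _ X_ne_zero) hne, natDegree_X_pow]
      omega
    have hcop : IsCoprime ((X - 1 : F[X]) ^ (k + 1)) (X ^ m) := by
      apply IsCoprime.pow
      exact ⟨-1, 1, by ring⟩
    obtain ⟨r, hr⟩ : (X - 1) ^ (k + 1) ∣ h := hcop.dvd_of_dvd_mul_left (hfh ▸ ⟨q, hq⟩)
    have hder : (X - 1) ^ k ∣ derivative h := by
      rw [hr, derivative_mul, derivative_pow]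
      refine dvd_add ?_ ?_
      · simp only [Nat.add_sub_cancel]
        exact dvd_mul_of_dvd_left (dvd_mul_of_dvd_left (dvd_mul_left _ _) _) _
      · exact dvd_mul_of_dvd_left (pow_dvd_pow _ (Nat.le_succ k)) _
    have hcoeff : ∀ i, i + 1 < p → ((i : F) + 1) ≠ 0 := by
      intro i hi h0
      have : ((i + 1 : ℕ) : F) = 0 := by exact_mod_cast h0
      rw [CharP.cast_eq_zero_iff F p] at this
      exact absurd (Nat.le_of_dvd (Nat.succ_pos i) this) (by omega)
    have hder0 : derivative h ≠ 0 := by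
      intro h0
      have hC : h = C (h.coeff 0) := by
        ext i
        rcases i with _ | i
        · simp
        · rw [coeff_C_succ]
          by_contra hi
          have hlt : i + 1 < p := (le_natDegree_of_ne_zero hi).trans_lt hdh
          have := congrArg (fun q => q.coeff i) h0
          simp only [coeff_derivative, coeff_zero, mul_eq_zero] at this
          exact this.elim hi (hcoeff i hlt)
      have he : h.eval 1 = 0 := by rw [hr]; simp
      rw [hC, eval_C] at he
      exact hh0 he
    have hlt := ih hder0 ((natDegree_derivative_le h).trans_lt (by omega)) hder
    have hsub : (derivative h).support.card + 1 ≤ h.support.card := by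
      have h0 : 0 ∈ h.support := by simpa using hh0
      rw [← Finset.card_erase_add_one h0]
      refine Nat.add_le_add_right ?_ 1
      rw [← Finset.card_map (addRightEmbedding 1) (s := (derivative h).support)]
      apply Finset.card_le_card
      intro i hi
      simp only [Finset.mem_map, mem_support_iff, coeff_derivative, addRightEmbedding_apply] at hi
      obtain ⟨j, hj, rfl⟩ := hi
      simp only [Finset.mem_erase, mem_support_iff]
      exact ⟨by omega, left_ne_zero_of_mul hj⟩
    omega

/-- A polynomial with few terms has few roots congruent to `1` modulo a prime element `π` of residue
characteristic `p`: after dividing by the largest power of `π`, it remains nonzero modulo `π`. -/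
theorem lt_card_support_of_roots_mod {A : Type*} [CommRing A] [IsDomain A] [IsNoetherianRing A]
    {p : ℕ} [Fact p.Prime] {π : A} (hπ : Prime π) (hp : π ∣ (p : A)) {f : A[X]} (hf : f ≠ 0)
    (hdeg : f.natDegree < p) (S : Finset A) (hS : ∀ x ∈ S, π ∣ x - 1)
    (hroot : ∀ x ∈ S, f.eval x = 0) :
    S.card < f.support.card := by
  obtain ⟨m, h, hh, hfh⟩ := WfDvdMonoid.max_power_factor' hf (prime_C_iff.2 hπ).not_isUnit
  have hsupp : f.support = h.support := by
    ext i
    rw [hfh, ← C_pow]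
    simp only [mem_support_iff, coeff_C_mul, ne_eq, mul_eq_zero,
      pow_ne_zero m hπ.ne_zero, false_or]
  have hne : h ≠ 0 := by rintro rfl; simp at hh
  have hroot' : ∀ x ∈ S, h.eval x = 0 := by
    intro x hx
    have := hroot x hx
    rw [hfh, ← C_pow, eval_mul, eval_C] at this
    exact (mul_eq_zero.1 this).resolve_left (pow_ne_zero _ hπ.ne_zero)
  have hdvd : ∏ x ∈ S, (X - C x) ∣ h := by
    refine (Multiset.prod_X_sub_C_dvd_iff_le_roots hne S.val).2 ?_
    rw [Multiset.le_iff_subset S.nodup]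
    intro x hx
    exact (mem_roots hne).2 (hroot' x hx)
  let I := Ideal.span {π}
  have hI : I.IsPrime := (Ideal.span_singleton_prime hπ.ne_zero).2 hπ
  let φ := Ideal.Quotient.mk I
  have hφ : ∀ x, φ x = 0 ↔ π ∣ x := fun x =>
    Ideal.Quotient.eq_zero_iff_mem.trans Ideal.mem_span_singleton
  have : CharP (A ⧸ I) p := by
    have h0 : ((p : ℕ) : A ⧸ I) = 0 := by
      have := (hφ p).2 hp
      simpa using this
    exact (CharP.charP_iff_prime_eq_zero Fact.out).2 h0
  have hmap : h.map φ ≠ 0 := by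
    intro h0
    apply hh
    rw [C_dvd_iff_dvd_coeff]
    intro i
    rw [← hφ, ← coeff_map, h0, coeff_zero]
  have hpow : (X - 1) ^ S.card ∣ h.map φ := by
    have := map_dvd φ hdvd
    rw [Polynomial.map_prod, Finset.prod_congr rfl (g := fun _ => X - 1)] at this
    · simpa using this
    · intro x hx
      have h1 : φ x = 1 := by
        have := (hφ _).2 (hS x hx)
        rwa [map_sub, map_one, sub_eq_zero] at this
      simp [h1]
  have hdh : h.natDegree < p := by
    rwa [hfh, ← C_pow, natDegree_C_mul (pow_ne_zero m hπ.ne_zero)] at hdeg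
  calc S.card < (h.map φ).support.card :=
        lt_card_support_of_X_sub_one_pow_dvd _ hmap (natDegree_map_le.trans_lt hdh) hpow
    _ ≤ f.support.card := hsupp ▸ Finset.card_le_card (support_map_subset φ h)

/-- A nonzero polynomial of degree less than a prime `n`, over a field of characteristic zero, has
more terms than it has `n`-th roots of unity among its roots. This is equivalent to Chebotarev's
theorem that every minor of the matrix `(ζ ^ (i * j))` is nonzero. -/
theorem card_lt_card_support_of_roots_of_unity {L : Type*} [Field L] [CharZero L] [IsAlgClosed L]
    {n : ℕ} [Fact n.Prime] {f : L[X]} (hf : f ≠ 0) (hdeg : f.natDegree < n) (S : Finset L)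
    (hS : ∀ x ∈ S, x ^ n = 1) (hroot : ∀ x ∈ S, f.eval x = 0) : S.card < f.support.card := by
  by_contra! hle
  obtain ⟨S', hS'S, hcard⟩ := Finset.exists_subset_card_eq hle
  have : NeZero n := ⟨(Fact.out : n.Prime).ne_zero⟩
  let K := CyclotomicField n ℚ
  have : IsCyclotomicExtension {n} ℚ K := CyclotomicField.isCyclotomicExtension n ℚ
  have : NumberField K := IsCyclotomicExtension.numberField {n} ℚ K
  let A := NumberField.RingOfIntegers K
  have hζ := IsCyclotomicExtension.zeta_spec n ℚ K
  have hζA : IsPrimitiveRoot hζ.toInteger n := hζ.toInteger_isPrimitiveRoot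
  let ψ : K →ₐ[ℚ] L := IsAlgClosed.lift
  let φ : A →+* L := ψ.toRingHom.comp (algebraMap A K)
  have hφ : Function.Injective φ :=
    ψ.toRingHom.injective.comp (FaithfulSMul.algebraMap_injective A K)
  have hζL : IsPrimitiveRoot (φ hζ.toInteger) n := hζA.map_of_injective hφ
  let σ : f.support ≃ S' := Fintype.equivOfCardEq (by simp [hcard])
  have hex : ∀ i : f.support, ∃ a : ℕ, φ hζ.toInteger ^ a = σ i := fun i =>
    let ⟨a, _, ha⟩ := hζL.eq_pow_of_pow_eq_one (hS _ (hS'S (σ i).2))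
    ⟨a, ha⟩
  choose a ha using hex
  let M : Matrix f.support f.support A := Matrix.of fun i j => (hζ.toInteger ^ a i) ^ (j : ℕ)
  -- a relation among the columns over `L` makes the determinant vanish, already in `A`
  have hdet : M.det = 0 := by
    apply hφ
    rw [map_zero, RingHom.map_det, ← Matrix.exists_mulVec_eq_zero_iff]
    refine ⟨fun j => f.coeff j, ?_, ?_⟩
    · obtain ⟨i, hi⟩ := Polynomial.nonempty_support_iff.2 hf
      exact fun h => mem_support_iff.1 hi (congrFun h ⟨i, hi⟩)
    · ext i
      have := hroot _ (hS'S (σ i).2)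
      rw [eval_eq_sum, Polynomial.sum, ← Finset.sum_coe_sort] at this
      simp only [Matrix.mulVec, dotProduct, RingHom.mapMatrix_apply, Matrix.map_apply, M,
        Matrix.of_apply, map_pow, ha, Pi.zero_apply]
      simpa only [mul_comm] using this
  obtain ⟨v, hv, hMv⟩ := Matrix.exists_mulVec_eq_zero_iff.2 hdet
  let h : A[X] := ∑ j : f.support, monomial (j : ℕ) (v j)
  have hcoeff : ∀ j : f.support, h.coeff j = v j := by
    intro j
    simp [h, coeff_monomial]
  have hsupp : h.support ⊆ f.support := by
    intro i hi
    by_contra hif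
    refine mem_support_iff.1 hi ?_
    simp only [h, finsetSum_coeff, coeff_monomial]
    exact Finset.sum_eq_zero fun j _ => if_neg fun (hji : (j : ℕ) = i) => hif (hji ▸ j.2)
  have hne : h ≠ 0 := by
    rintro h0
    exact hv (funext fun j => by rw [← hcoeff j, h0]; rfl)
  have hinj : Function.Injective fun i => hζ.toInteger ^ a i := by
    intro i j hij
    have := congrArg φ hij
    simp only [map_pow, ha] at this
    exact σ.injective (Subtype.ext this)
  have hpr : Prime (hζ.toInteger - 1) := hζ.zeta_sub_one_prime'
  have hlt := lt_card_support_of_roots_mod hpr (p := n) ?_ hne ?_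
    (Finset.univ.map ⟨_, hinj⟩) ?_ ?_
  · rw [Finset.card_map, Finset.card_univ, Fintype.card_coe] at hlt
    exact absurd (Finset.card_le_card hsupp) (not_le.2 hlt)
  · exact hζ.toInteger_sub_one_dvd_prime'
  · refine lt_of_le_of_lt ?_ hdeg
    exact natDegree_le_iff_coeff_eq_zero.2 fun i hi =>
      notMem_support_iff.1 fun h => hi.not_ge (le_natDegree_of_mem_supp i (hsupp h))
  · intro x hx
    obtain ⟨i, -, rfl⟩ := Finset.mem_map.1 hx
    simpa using sub_dvd_pow_sub_pow hζ.toInteger 1 (a i)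
  · intro x hx
    obtain ⟨i, -, rfl⟩ := Finset.mem_map.1 hx
    have := congrFun hMv i
    simp only [Matrix.mulVec, dotProduct, M, Matrix.of_apply, Pi.zero_apply] at this
    simp only [h, eval_finsetSum, eval_monomial, Function.Embedding.coeFn_mk]
    simpa only [mul_comm] using this

/-! ### Divisors of `X ^ n - 1` over an algebraically closed field -/

section Roots

variable {R L : Type*} [CommRing R] [Field L] {φ : R →+* L} {n : ℕ} {g : R[X]}

theorem pow_eq_one_of_eval_map_eq_zero (hg : g ∣ X ^ n - 1) {z : L} (hz : (g.map φ).eval z = 0) :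
    z ^ n = 1 := by
  obtain ⟨q, hq⟩ := map_dvd φ hg
  have := congrArg (eval z) hq
  simp only [Polynomial.map_sub, Polynomial.map_pow, map_X, Polynomial.map_one, eval_sub, eval_pow,
    eval_X, eval_one, eval_mul, hz, zero_mul] at this
  exact sub_eq_zero.1 this

variable [CharZero L]

theorem separable_map_of_dvd (hn : n ≠ 0) (hg : g ∣ X ^ n - 1) : (g.map φ).Separable := by
  refine Separable.of_dvd ?_ (map_dvd φ hg)
  simpa using separable_X_pow_sub_C (1 : L) (Nat.cast_ne_zero.2 hn) one_ne_zero

variable [IsAlgClosed L]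

theorem card_roots_map_toFinset [DecidableEq L] (hφ : Function.Injective φ) (hn : n ≠ 0)
    (hg : g ∣ X ^ n - 1) : (g.map φ).roots.toFinset.card = g.natDegree := by
  rw [Multiset.toFinset_card_of_nodup (nodup_roots (separable_map_of_dvd hn hg)),
    ← (IsAlgClosed.splits (g.map φ)).natDegree_eq_card_roots, natDegree_map_eq_of_injective hφ]

/-- A nonzero word of the cyclic code generated by `g`, of prime length, has weight greater than the
degree of `g`. -/
theorem natDegree_lt_card_support_of_dvd [Fact n.Prime] (hφ : Function.Injective φ)
    (hg : g ∣ X ^ n - 1) {f : R[X]} (hf : f ≠ 0) (hdeg : f.natDegree < n) (hgf : g ∣ f) :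
    g.natDegree < f.support.card := by
  classical
  have hn : n ≠ 0 := (Fact.out : n.Prime).ne_zero
  have hg0 : g.map φ ≠ 0 := (separable_map_of_dvd hn hg).ne_zero
  have hf0 : f.map φ ≠ 0 := (Polynomial.map_ne_zero_iff hφ).2 hf
  have h := card_lt_card_support_of_roots_of_unity hf0 (natDegree_map_le.trans_lt hdeg)
    (g.map φ).roots.toFinset
    (fun z hz => pow_eq_one_of_eval_map_eq_zero hg
      ((mem_roots hg0).1 (Multiset.mem_toFinset.1 hz)))
    (fun z hz => eval_eq_zero_of_dvd_of_eval_eq_zero (map_dvd φ hgf)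
      ((mem_roots hg0).1 (Multiset.mem_toFinset.1 hz)))
  rw [card_roots_map_toFinset hφ hn hg] at h
  exact h.trans_le (Finset.card_le_card (support_map_subset φ f))

end Roots

/-! ### Extended cyclic codes of prime length -/

section Extended

variable {R : Type*} [CommRing R] {κ : Type*}

/-- The codeword of the message polynomial `b`: the coefficients of `b * g`, placed on the
coordinates `κ` by their exponents `ν`, extended by the entry `x * b(1)`. -/
def encode (g : R[X]) (x : R) (ν : κ → ℕ) : R[X] →ₗ[R] (Option κ → R) where
  toFun b := append (fun j => (b * g).coeff (ν j)) (x * b.eval 1)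
  map_add' b c := by
    funext j
    cases j <;> simp [append, add_mul, mul_add]
  map_smul' r b := by
    funext j
    cases j <;> simp [append]; ring

@[simp]
theorem encode_some (g : R[X]) (x : R) (ν : κ → ℕ) (b : R[X]) (j : κ) :
    encode g x ν b (some j) = (b * g).coeff (ν j) := rfl

@[simp]
theorem encode_none (g : R[X]) (x : R) (ν : κ → ℕ) (b : R[X]) :
    encode g x ν b none = x * b.eval 1 := rfl

open Classical in
theorem hammingNorm_option [Fintype κ] (w : Option κ → R) :
    hammingNorm w = (Finset.univ.filter fun j => w (some j) ≠ 0).card +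
      if w none = 0 then 0 else 1 := by
  rw [hammingNorm, Finset.card_filter, Fintype.sum_option, add_comm, Finset.card_filter]
  simp only [ne_eq, ite_not]

open Classical in
theorem card_coeff_ne_zero [Fintype κ] {ν : κ → ℕ} {n : ℕ} (hν : Function.Injective ν)
    (hr : Set.range ν = Set.Iio n) {f : R[X]} (hf : ∀ i, n ≤ i → f.coeff i = 0) :
    (Finset.univ.filter fun j => f.coeff (ν j) ≠ 0).card = f.support.card := by
  rw [← Finset.card_map ⟨ν, hν⟩]
  congr 1
  ext i
  simp only [Finset.mem_map, Finset.mem_filter, Finset.mem_univ, true_and, mem_support_iff,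
    Function.Embedding.coeFn_mk]
  constructor
  · rintro ⟨j, hj, rfl⟩
    exact hj
  · intro hi
    have : i ∈ Set.range ν := by
      rw [hr]
      exact not_le.1 fun h => hi (hf i h)
    obtain ⟨j, rfl⟩ := this
    exact ⟨j, hi, rfl⟩

theorem card_eq_of_range_eq_Iio [Fintype κ] {ν : κ → ℕ} {n : ℕ} (hν : Function.Injective ν)
    (hr : Set.range ν = Set.Iio n) : Fintype.card κ = n := by
  rw [← Set.card_range_of_injective hν, Fintype.card_congr (Equiv.setCongr hr)]
  simp

open Classical in
theorem hammingNorm_encode [Fintype κ] {g : R[X]} {x : R} {ν : κ → ℕ} {n : ℕ}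
    (hν : Function.Injective ν) (hr : Set.range ν = Set.Iio n) {b : R[X]}
    (hb : (b * g).natDegree < n) :
    hammingNorm (encode g x ν b) = (b * g).support.card + if x * b.eval 1 = 0 then 0 else 1 := by
  rw [hammingNorm_option,
    ← card_coeff_ne_zero hν hr fun i hi => coeff_eq_zero_of_natDegree_lt (hb.trans_le hi)]
  rfl

variable [IsDomain R] [CharZero R] {g : R[X]} {x : R} {ν : κ → ℕ} {k n : ℕ}

open Classical in
/-- The key bound: `b * g` has more terms than `g` has roots, and more than `(X - 1) * g` has roots
if `b(1) = 0`, which is exactly when the added coordinate of the codeword vanishes. -/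
theorem lt_hammingNorm_encode [Fintype κ] [Fact n.Prime] (hn : n + 1 = 2 * k)
    (hg : g ∣ X ^ n - 1) (hgd : g.natDegree + 1 = k) (hg1 : g.eval 1 ≠ 0) (hx : x ≠ 0)
    (hν : Function.Injective ν) (hr : Set.range ν = Set.Iio n) {b : R[X]} (hb : b ∈ degreeLT R k)
    (hb0 : b ≠ 0) : k < hammingNorm (encode g x ν b) := by
  have hg0 : g ≠ 0 := by rintro rfl; simp at hg1
  have hbd : b.natDegree < k := (natDegree_lt_iff_degree_lt hb0).2 (mem_degreeLT.1 hb)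
  have hdeg : (b * g).natDegree < n := natDegree_mul_le.trans_lt (by omega)
  let L := AlgebraicClosure (FractionRing R)
  let φ : R →+* L := (algebraMap (FractionRing R) L).comp (algebraMap R (FractionRing R))
  have hφ : Function.Injective φ :=
    (algebraMap (FractionRing R) L).injective.comp (IsFractionRing.injective R (FractionRing R))
  have : CharZero L := charZero_of_injective_ringHom hφ
  rw [hammingNorm_encode hν hr hdeg]
  simp only [mul_eq_zero, hx, false_or]
  split_ifs with hb1
  · have hdvd : (X - C 1) * g ∣ X ^ n - 1 := by
      obtain ⟨q, hq⟩ := hg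
      have : q.IsRoot 1 := by
        have := congrArg (eval 1) hq
        simp only [eval_sub, eval_pow, eval_X, one_pow, eval_one, sub_self, eval_mul] at this
        exact (mul_eq_zero.1 this.symm).resolve_left hg1
      rw [hq, mul_comm]
      exact mul_dvd_mul_left g (dvd_iff_isRoot.2 this)
    have := natDegree_lt_card_support_of_dvd hφ hdvd (mul_ne_zero hb0 hg0) hdeg
      (mul_dvd_mul_right (dvd_iff_isRoot.2 hb1) g)
    rw [natDegree_mul (X_sub_C_ne_zero 1) hg0, natDegree_X_sub_C] at this
    omega
  · have := natDegree_lt_card_support_of_dvd hφ hg (mul_ne_zero hb0 hg0) hdeg (dvd_mul_left g b)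
    omega

theorem injective_domRestrict_encode [Fintype κ] [Fact n.Prime] (hn : n + 1 = 2 * k)
    (hg : g ∣ X ^ n - 1) (hgd : g.natDegree + 1 = k) (hg1 : g.eval 1 ≠ 0) (hx : x ≠ 0)
    (hν : Function.Injective ν) (hr : Set.range ν = Set.Iio n) :
    Function.Injective ((encode g x ν).domRestrict (degreeLT R k)) := by
  classical
  rw [← LinearMap.ker_eq_bot, LinearMap.ker_eq_bot']
  rintro ⟨b, hb⟩ h0
  by_contra hne
  have := lt_hammingNorm_encode hn hg hgd hg1 hx hν hr hb fun h => hne (Subtype.ext h)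
  rw [LinearMap.domRestrict_apply] at h0
  simp [h0] at this

theorem isMinHammingDist_encode [Fintype κ] [Fact n.Prime] (hn : n + 1 = 2 * k)
    (hg : g ∣ X ^ n - 1) (hgd : g.natDegree + 1 = k) (hg1 : g.eval 1 ≠ 0) (hx : x ≠ 0)
    (hν : Function.Injective ν) (hr : Set.range ν = Set.Iio n) :
    IsMinHammingDist ((degreeLT R k).map (encode g x ν)) (k + 1) := by
  classical
  have hlow : ∀ w ∈ (degreeLT R k).map (encode g x ν), w ≠ 0 → k < hammingNorm w := by
    rintro _ ⟨b, hb, rfl⟩ hw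
    exact lt_hammingNorm_encode hn hg hgd hg1 hx hν hr hb (by rintro rfl; simp at hw)
  constructor
  · have h1 : (1 : R[X]) ∈ degreeLT R k :=
      mem_degreeLT.2 (degree_one_le.trans_lt (by exact_mod_cast (by omega : 0 < k)))
    have hlt := lt_hammingNorm_encode hn hg hgd hg1 hx hν hr h1 one_ne_zero
    refine ⟨_, ⟨1, h1, rfl⟩, 0, zero_mem _, ?_, ?_⟩
    · intro h
      rw [h] at hlt
      simp at hlt
    · have hle : hammingNorm (encode g x ν 1) ≤ k + 1 := by
        rw [hammingNorm_encode hν hr (by rw [one_mul]; omega), one_mul]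
        have := (Finset.card_le_card supp_subset_range_natDegree_succ).trans_eq
          (Finset.card_range (g.natDegree + 1))
        split_ifs <;> omega
      rw [hammingDist_zero_right]
      exact le_antisymm hle (Nat.succ_le_of_lt hlt)
  · rintro _ ⟨u, hu, v, hv, huv, rfl⟩
    rw [hammingDist_eq_hammingNorm, neg_add_eq_sub]
    exact Nat.succ_le_of_lt (hlow _ (sub_mem hv hu) (sub_ne_zero.2 huv.symm))

theorem finrank_encode [Fintype κ] [Fact n.Prime] (hn : n + 1 = 2 * k)
    (hg : g ∣ X ^ n - 1) (hgd : g.natDegree + 1 = k) (hg1 : g.eval 1 ≠ 0) (hx : x ≠ 0)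
    (hν : Function.Injective ν) (hr : Set.range ν = Set.Iio n) :
    Module.finrank R ((degreeLT R k).map (encode g x ν)) = k := by
  have h := injective_domRestrict_encode hn hg hgd hg1 hx hν hr
  rw [← LinearMap.range_domRestrict, LinearMap.finrank_range_of_inj h,
    (degreeLTEquiv R k).finrank_eq, Module.finrank_fin_fun]

end Extended

/-! ### Maximum distance separable codes -/

/-- A codeword that vanishes on `k` coordinates has weight at most `N - k < d`, so it is zero; and
the rows of a generator matrix with as many rows as the rank are independent. -/
theorem columnsIndependent_of_isMDS {R ι : Type*} [CommRing R] [IsDomain R] [Fintype ι]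
    {C : Submodule R (ι → R)} (hC : IsMDS C) : ColumnsIndependent C := by
  classical
  obtain ⟨d, hd, hdk⟩ := hC
  intro G hG S hS
  rw [Fintype.linearIndependent_iff]
  by_contra! hdep
  obtain ⟨v, hv, j, hvj⟩ := hdep
  let e : Fin (Module.finrank R C) ≃ S := Fintype.equivOfCardEq (by simp [hS])
  have hdet : (Matrix.of fun i i' => G i (e i')).det = 0 := by
    rw [← Matrix.exists_mulVec_eq_zero_iff]
    refine ⟨fun i => v (e i), fun h0 => hvj ?_, ?_⟩
    · simpa using congrFun h0 (e.symm j)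
    · ext i
      have := congrFun hv i
      simp only [Finset.sum_apply, Pi.smul_apply, smul_eq_mul, Pi.zero_apply] at this
      rw [Pi.zero_apply, ← this, ← Equiv.sum_comp e]
      simp only [Matrix.mulVec, dotProduct, Matrix.of_apply]
      exact Finset.sum_congr rfl fun _ _ => mul_comm _ _
  obtain ⟨u, hu, huG⟩ := Matrix.exists_vecMul_eq_zero_iff.2 hdet
  have hw : ∑ i, u i • G.row i ∈ C := by
    exact C.sum_mem fun i _ => C.smul_mem _ (hG.le (Submodule.subset_span ⟨i, rfl⟩))
  have hwS : ∀ s ∈ S, (∑ i, u i • G.row i) s = 0 := by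
    intro s hs
    have := congrFun huG (e.symm ⟨s, hs⟩)
    simpa [Matrix.vecMul, dotProduct] using this
  have hw0 : ∑ i, u i • G.row i = 0 := by
    by_contra hne
    have h1 := hd.2 ⟨_, hw, 0, zero_mem _, hne, rfl⟩
    have h2 : hammingNorm (∑ i, u i • G.row i) ≤ Sᶜ.card := by
      refine Finset.card_le_card fun s hs => Finset.mem_compl.2 fun hsS => ?_
      exact (Finset.mem_filter.1 hs).2 (hwS s hsS)
    rw [Finset.card_compl] at h2
    rw [hammingDist_zero_right] at h1
    have := S.card_le_univ
    omega
  let r : Fin (Module.finrank R C) → C := fun i => ⟨G.row i, hG.le (Submodule.subset_span ⟨i, rfl⟩)⟩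
  have hspan : ⊤ ≤ Submodule.span R (Set.range r) := by
    intro c _
    have hc := hG.ge c.2
    rw [show G.row = C.subtype ∘ r from rfl, Set.range_comp, ← Submodule.map_span] at hc
    obtain ⟨c', hc', h⟩ := hc
    exact Subtype.ext h ▸ hc'
  have hlin := linearIndependent_of_top_le_span_of_card_eq_finrank hspan (by simp)
  rw [Fintype.linearIndependent_iff] at hlin
  refine hu (funext (hlin u (Subtype.ext ?_)))
  simpa [r] using hw0

theorem isMDS_encode {R κ : Type*} [CommRing R] [IsDomain R] [CharZero R] [Fintype κ] {g : R[X]}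
    {x : R} {ν : κ → ℕ} {k n : ℕ} [Fact n.Prime] (hn : n + 1 = 2 * k)
    (hg : g ∣ X ^ n - 1) (hgd : g.natDegree + 1 = k) (hg1 : g.eval 1 ≠ 0) (hx : x ≠ 0)
    (hν : Function.Injective ν) (hr : Set.range ν = Set.Iio n) :
    IsMDS ((degreeLT R k).map (encode g x ν)) := by
  refine ⟨k + 1, isMinHammingDist_encode hn hg hgd hg1 hx hν hr, ?_⟩
  rw [finrank_encode hn hg hgd hg1 hx hν hr, Fintype.card_option, card_eq_of_range_eq_Iio hν hr]
  omega

/-! ### Words and their polynomials -/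

section Words

variable {R : Type*} [CommRing R] {n : ℕ} [NeZero n]

theorem wordPoly_apply (c : ZMod n → R) : wordPoly n c = ∑ j, monomial j.val (c j) := by
  simp [wordPoly, LinearMap.sum_apply]

theorem coeff_wordPoly_val (c : ZMod n → R) (j : ZMod n) : (wordPoly n c).coeff j.val = c j := by
  rw [wordPoly_apply, finsetSum_coeff, Finset.sum_eq_single j]
  · simp
  · intro i _ hi
    rw [coeff_monomial, if_neg fun h => hi (ZMod.val_injective n h)]
  · simp

theorem coeff_wordPoly_of_le (c : ZMod n → R) {i : ℕ} (hi : n ≤ i) :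
    (wordPoly n c).coeff i = 0 := by
  rw [wordPoly_apply, finsetSum_coeff]
  exact Finset.sum_eq_zero fun j _ =>
    coeff_monomial_of_ne _ fun h => absurd (ZMod.val_lt j) (by omega)

theorem wordPoly_injective : Function.Injective (wordPoly (R := R) n) := fun c d h =>
  funext fun j => by rw [← coeff_wordPoly_val c, h, coeff_wordPoly_val]

theorem eq_wordPoly_of_coeff {f : R[X]} {c : ZMod n → R} (hf : f.degree < n)
    (hc : ∀ j : ZMod n, c j = f.coeff j.val) : wordPoly n c = f := by
  ext i
  by_cases hi : i < n
  · have := coeff_wordPoly_val c (i : ZMod n)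
    rwa [hc, ZMod.val_cast_of_lt hi] at this
  · rw [coeff_wordPoly_of_le c (not_lt.1 hi)]
    exact (coeff_eq_zero_of_degree_lt (hf.trans_le (by exact_mod_cast not_lt.1 hi))).symm

theorem degree_wordPoly_lt (c : ZMod n → R) : (wordPoly n c).degree < n :=
  (degree_lt_iff_coeff_zero _ _).2 fun _ hi => coeff_wordPoly_of_le c hi

theorem eval_map_wordPoly {L : Type*} [CommRing L] (φ : R →+* L) (c : ZMod n → R) (z : L) :
    ((wordPoly n c).map φ).eval z = ∑ j, φ (c j) * z ^ j.val := by
  simp [wordPoly_apply, Polynomial.map_sum, eval_finsetSum]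

theorem pow_val_add {L : Type*} [CommRing L] {z : L} (hz : z ^ n = 1) (a b : ZMod n) :
    z ^ (a + b).val = z ^ a.val * z ^ b.val := by
  rw [ZMod.val_add, ← pow_add, ← pow_eq_pow_mod _ hz]

theorem X_pow_sub_one_dvd_pow_sub_pow_mod (n a : ℕ) :
    (X ^ n - 1 : R[X]) ∣ X ^ (a % n) - X ^ a := by
  have h1 := sub_dvd_pow_sub_pow (X ^ n : R[X]) 1 (a / n)
  have h2 : (X ^ a : R[X]) = X ^ (a % n) * (X ^ n) ^ (a / n) := by
    rw [← pow_mul, ← pow_add, Nat.mod_add_div]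
  rw [one_pow] at h1
  rw [h2, ← mul_one_sub, ← neg_sub ((X ^ n : R[X]) ^ _), mul_neg, dvd_neg]
  exact h1.mul_left _

/-- Shifting a word by `i` multiplies its polynomial by `X ^ i` modulo `X ^ n - 1`. -/
theorem dvd_wordPoly_shift_sub (c : ZMod n → R) (i : ZMod n) :
    X ^ n - 1 ∣ wordPoly n (fun j => c (j - i)) - X ^ i.val * wordPoly n c := by
  have hsum : wordPoly n (fun j => c (j - i)) = ∑ t, C (c t) * X ^ (t + i).val := by
    rw [wordPoly_apply, ← Equiv.sum_comp (Equiv.addRight i)]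
    simp [C_mul_X_pow_eq_monomial]
  have hmul : X ^ i.val * wordPoly n c = ∑ t, C (c t) * X ^ (t.val + i.val) := by
    rw [wordPoly_apply, Finset.mul_sum]
    refine Finset.sum_congr rfl fun t _ => ?_
    rw [← C_mul_X_pow_eq_monomial, pow_add]
    ring
  rw [hsum, hmul, ← Finset.sum_sub_distrib]
  refine Finset.dvd_sum fun t _ => ?_
  rw [← mul_sub, ZMod.val_add]
  exact (X_pow_sub_one_dvd_pow_sub_pow_mod n _).mul_left _

theorem mem_cyclicCode {g : R[X]} {c : ZMod n → R} :
    c ∈ cyclicCode n g ↔ ∃ u v, u * g + v * (X ^ n - 1) = wordPoly n c := by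
  rw [cyclicCode, Submodule.mem_comap, Submodule.restrictScalars_mem, Ideal.mem_span_pair]

theorem mem_cyclicCode_of_dvd {g : R[X]} (hg : g ∣ X ^ n - 1) {c : ZMod n → R} :
    c ∈ cyclicCode n g ↔ g ∣ wordPoly n c := by
  rw [mem_cyclicCode]
  constructor
  · rintro ⟨u, v, h⟩
    exact h ▸ dvd_add (dvd_mul_left g u) (hg.mul_left v)
  · rintro ⟨u, hu⟩
    exact ⟨u, 0, by rw [hu]; ring⟩

/-- Since `n` is invertible, `X ^ n - 1 = g * h` is separable, so `p * g + q * h = 1` for some `p`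
and `q`; the idempotent is `p * g`. -/
theorem exists_isIdempotentGenerator [Nontrivial R] (hn : IsUnit (n : R)) {g : R[X]}
    (hg : g ∣ X ^ n - 1) : ∃ e, IsIdempotentGenerator n (cyclicCode n g) e := by
  have hmon : (X ^ n - 1 : R[X]).Monic := monic_X_pow_sub_C 1 (NeZero.ne n)
  have hsep : (X ^ n - 1 : R[X]).Separable := by
    simpa using separable_X_pow_sub_C_unit (1 : Rˣ) hn
  obtain ⟨h, hh⟩ := id hg
  obtain ⟨p, q, hpq⟩ : IsCoprime g h := (hh ▸ hsep).isCoprime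
  let E := (p * g) %ₘ (X ^ n - 1)
  have hE : wordPoly n (fun j => E.coeff j.val) = E := by
    refine eq_wordPoly_of_coeff ?_ fun j => rfl
    have := degree_modByMonic_lt (p * g) hmon
    rwa [← C_1, degree_X_pow_sub_C (NeZero.pos n)] at this
  have hEd : E = p * g - (X ^ n - 1) * ((p * g) /ₘ (X ^ n - 1)) := modByMonic_eq_sub_mul_div ..
  set D := (p * g) /ₘ (X ^ n - 1)
  refine ⟨fun j => E.coeff j.val, ?_, ?_⟩
  · rw [hE, hEd, hh]
    refine ⟨-p * q - 2 * p * g * D + D + g * h * D ^ 2, ?_⟩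
    linear_combination (p * g) * hpq
  · ext c
    rw [mem_cyclicCode_of_dvd hg, mem_cyclicCode, hE]
    constructor
    · rintro ⟨u, v, huv⟩
      rw [← huv, hEd]
      exact dvd_add ((dvd_sub (dvd_mul_left g p) (hg.mul_right D)).mul_left u) (hg.mul_left v)
    · rintro ⟨b, hb⟩
      refine ⟨b * g, b * q + b * g * D, ?_⟩
      rw [hb, hEd, hh]
      linear_combination (b * g) * hpq

/-- The idempotent generator takes the value `1` at `1`, because its value there is a nonzero
idempotent. So the entry appended to a codeword of polynomial `c` is `x * c(1)`. -/
theorem mem_extendedCode [IsDomain R] (hn : IsUnit (n : R)) {g : R[X]} (hg : g ∣ X ^ n - 1)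
    (hgd : g.degree < n) (hg1 : g.eval 1 ≠ 0) {x : R} {w : Option (ZMod n) → R} :
    w ∈ extendedCode n (cyclicCode n g) x ↔ g ∣ wordPoly n (fun j => w (some j)) ∧
      w none = x * (wordPoly n (fun j => w (some j))).eval 1 := by
  have hmon : (X ^ n - 1 : R[X]).Monic := monic_X_pow_sub_C 1 (NeZero.ne n)
  have heval : ∀ {f : R[X]}, X ^ n - 1 ∣ f → f.eval 1 = 0 := fun hf =>
    eval_eq_zero_of_dvd_of_eval_eq_zero hf (by simp)
  have hE1 : ∀ e, IsIdempotentGenerator n (cyclicCode n g) e → (wordPoly n e).eval 1 = 1 := by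
    rintro e ⟨he, heC⟩
    have h2 := heval he
    rw [eval_sub, eval_pow, sq, ← mul_sub_one, mul_eq_zero, sub_eq_zero] at h2
    refine h2.resolve_left fun h0 => hg1 ?_
    have hgw : wordPoly n (fun j => g.coeff j.val) = g := eq_wordPoly_of_coeff hgd fun _ => rfl
    have : (fun j : ZMod n => g.coeff j.val) ∈ cyclicCode n (wordPoly n e) := by
      rw [heC, mem_cyclicCode_of_dvd hg, hgw]
    obtain ⟨u, v, huv⟩ := mem_cyclicCode.1 this
    rw [← hgw, ← huv]
    simp [h0]
  constructor
  · intro hw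
    induction hw using Submodule.span_induction with
    | mem w hw =>
      obtain ⟨e, he, i, rfl⟩ := hw
      have hge : g ∣ wordPoly n e := by
        rw [← mem_cyclicCode_of_dvd hg, ← he.2, mem_cyclicCode]
        exact ⟨1, 0, by ring⟩
      have hs := dvd_wordPoly_shift_sub e i
      refine ⟨(dvd_sub_comm.1 (hg.trans hs) |> (dvd_sub_right (hge.mul_left _)).1), ?_⟩
      have := heval hs
      simp only [eval_sub, eval_mul, eval_pow, eval_X, one_pow, one_mul, hE1 e he] at this
      simp only [append]
      rw [sub_eq_zero.1 this, mul_one]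
    | zero =>
      have : wordPoly n (fun j => (0 : Option (ZMod n) → R) (some j)) = 0 := map_zero (wordPoly n)
      exact ⟨this ▸ dvd_zero g, by rw [this]; simp⟩
    | add u v _ _ hu hv =>
      have : wordPoly n (fun j => (u + v) (some j)) =
        wordPoly n (fun j => u (some j)) + wordPoly n (fun j => v (some j)) :=
        map_add (wordPoly n) _ _
      rw [this, eval_add, mul_add, ← hu.2, ← hv.2]
      exact ⟨dvd_add hu.1 hv.1, rfl⟩
    | smul a u _ hu =>
      have : wordPoly n (fun j => (a • u) (some j)) = a • wordPoly n (fun j => u (some j)) :=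
        map_smul (wordPoly n) a _
      rw [this, eval_smul, mul_smul_comm, ← hu.2]
      exact ⟨by rw [smul_eq_C_mul]; exact hu.1.mul_left _, rfl⟩
  · rintro ⟨hgw, hnone⟩
    obtain ⟨e, he⟩ := exists_isIdempotentGenerator hn hg
    have hw := (mem_cyclicCode_of_dvd hg).2 hgw
    rw [← he.2, mem_cyclicCode] at hw
    obtain ⟨u, v, huv⟩ := hw
    -- only the residue of the multiplier `u` modulo `X ^ n - 1` matters
    let U := u %ₘ (X ^ n - 1)
    let a : ZMod n → R := fun i => U.coeff i.val
    have hU : wordPoly n a = U := by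
      refine eq_wordPoly_of_coeff ?_ fun j => rfl
      have := degree_modByMonic_lt u hmon
      rwa [← C_1, degree_X_pow_sub_C (NeZero.pos n)] at this
    have hUd : U = u - (X ^ n - 1) * (u /ₘ (X ^ n - 1)) := modByMonic_eq_sub_mul_div ..
    have key : wordPoly n (fun j => w (some j)) =
        wordPoly n (∑ i, a i • fun j => e (j - i)) := by
      rw [← sub_eq_zero]
      refine eq_zero_of_dvd_of_degree_lt (p := X ^ n - 1) ?_ ?_
      · have h1 : X ^ n - 1 ∣ wordPoly n (∑ i, a i • fun j => e (j - i)) - U * wordPoly n e := by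
          rw [← hU, wordPoly_apply a, map_sum, Finset.sum_mul, ← Finset.sum_sub_distrib]
          refine Finset.dvd_sum fun i _ => ?_
          rw [map_smul, ← C_mul_X_pow_eq_monomial, mul_assoc, smul_eq_C_mul, ← mul_sub]
          exact (dvd_wordPoly_shift_sub e i).mul_left _
        have h2 : X ^ n - 1 ∣ wordPoly n (fun j => w (some j)) - U * wordPoly n e :=
          ⟨v + (u /ₘ (X ^ n - 1)) * wordPoly n e, by rw [← huv, hUd]; ring⟩
        simpa using dvd_sub h2 h1
      · rw [← map_sub, ← C_1, degree_X_pow_sub_C (NeZero.pos n)]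
        exact degree_wordPoly_lt _
    have hweq : w = ∑ i, a i • append (fun j => e (j - i)) x := by
      funext j
      cases j with
      | some j =>
        have := congrFun (wordPoly_injective key) j
        simpa [append, Finset.sum_apply] using this
      | none =>
        have h1 : (wordPoly n (fun j => w (some j))).eval 1 = U.eval 1 := by
          rw [← huv, hUd]
          simp [hE1 e he]
        have h2 := eval_map_wordPoly (RingHom.id R) a 1
        rw [hU, Polynomial.map_id] at h2
        rw [hnone, h1, h2]
        simp [append, Finset.sum_apply, Finset.mul_sum, mul_comm]
    rw [hweq]
    exact Submodule.sum_mem _ fun i _ =>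
      Submodule.smul_mem _ _ (Submodule.subset_span ⟨e, he, i, rfl⟩)

theorem extendedCode_eq_map_encode [IsDomain R] (hn : IsUnit (n : R)) {g : R[X]} {k : ℕ}
    (hg : g ∣ X ^ n - 1) (hk : n + 1 = 2 * k) (hgd : g.natDegree + 1 = k) (hg1 : g.eval 1 ≠ 0)
    (x : R) : extendedCode n (cyclicCode n g) x =
      (degreeLT R k).map (encode g (x * g.eval 1) ZMod.val) := by
  have hg0 : g ≠ 0 := by rintro rfl; simp at hg1
  have hdeg : ∀ {f : R[X]}, f.natDegree < n → f.degree < n := fun h =>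
    degree_le_natDegree.trans_lt (by exact_mod_cast h)
  ext w
  rw [mem_extendedCode hn hg (hdeg (by omega)) hg1]
  constructor
  · rintro ⟨⟨b, hb⟩, hnone⟩
    refine ⟨b, ?_, ?_⟩
    · rw [SetLike.mem_coe, mem_degreeLT]
      have := degree_wordPoly_lt (n := n) fun j => w (some j)
      rw [hb, degree_mul, degree_eq_natDegree hg0] at this
      by_cases hb0 : b = 0
      · simp [hb0]
      rw [degree_eq_natDegree hb0] at this ⊢
      norm_cast at this ⊢
      omega
    · funext j
      cases j with
      | some j => rw [encode_some, mul_comm, ← hb, coeff_wordPoly_val]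
      | none => rw [encode_none, hnone, hb, eval_mul, mul_assoc]
  · rintro ⟨b, hb, rfl⟩
    have : wordPoly n (fun j => encode g (x * g.eval 1) ZMod.val b (some j)) = b * g := by
      refine eq_wordPoly_of_coeff ?_ fun j => rfl
      by_cases hb0 : b = 0
      · simp [hb0]
      have hbd := (natDegree_lt_iff_degree_lt hb0).2 (mem_degreeLT.1 hb)
      exact hdeg (natDegree_mul_le.trans_lt (by omega))
    rw [this, encode_none, eval_mul]
    exact ⟨dvd_mul_left g b, by ring⟩

end Words

/-! ### Self-duality -/

section SelfDual

variable {L : Type*} [Field L] {n : ℕ} [NeZero n]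

theorem sum_pow_val_eq_zero {z : L} (hz : z ^ n = 1) (hz1 : z ≠ 1) :
    ∑ j : ZMod n, z ^ j.val = 0 := by
  have h : z ^ (1 : ZMod n).val * ∑ j : ZMod n, z ^ j.val = ∑ j : ZMod n, z ^ j.val := by
    rw [Finset.mul_sum, ← Equiv.sum_comp (Equiv.addLeft (1 : ZMod n)) fun j => z ^ j.val]
    exact Finset.sum_congr rfl fun j _ => (pow_val_add hz 1 j).symm
  have h1 : z ^ (1 : ZMod n).val = z := by
    rw [ZMod.val_one_eq_one_mod, ← pow_eq_pow_mod _ hz, pow_one]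
  rw [h1] at h
  exact (mul_eq_zero.1 (show (z - 1) * _ = 0 by rw [sub_one_mul, h, sub_self])).resolve_left
    (sub_ne_zero.2 hz1)

/-- The discrete Fourier transform of the correlation of two words. -/
theorem sum_pow_val_mul_correlation (a c : ZMod n → L) {z : L} (hz : z ^ n = 1) :
    ∑ s : ZMod n, z ^ s.val * ∑ j, a j * c (j - s) =
      (∑ j, a j * z ^ j.val) * ∑ j, c j * z⁻¹ ^ j.val := by
  have hz0 : z ≠ 0 := by
    rintro rfl
    simp [zero_pow (NeZero.ne n)] at hz
  rw [Finset.sum_congr rfl fun s _ => Finset.mul_sum .., Finset.sum_comm, Finset.sum_mul]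
  refine Finset.sum_congr rfl fun j _ => ?_
  rw [Finset.mul_sum, ← Equiv.sum_comp (Equiv.subLeft j)]
  refine Finset.sum_congr rfl fun t _ => ?_
  have h : z ^ j.val = z ^ (j - t).val * z ^ t.val := by
    rw [← pow_val_add hz, sub_add_cancel]
  have h1 : z ^ t.val * z⁻¹ ^ t.val = 1 := by rw [← mul_pow, mul_inv_cancel₀ hz0, one_pow]
  rw [Equiv.subLeft_apply, sub_sub_cancel, h]
  linear_combination -(a j * c t * z ^ (j - t).val) * h1

/-- Parseval's identity for the discrete Fourier transform. -/
theorem card_mul_dotProduct {ζ : L} (hζ : IsPrimitiveRoot ζ n) (a c : ZMod n → L) :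
    (n : L) * ∑ j, a j * c j = ∑ i : ZMod n,
      (∑ j, a j * (ζ ^ i.val) ^ j.val) * ∑ j, c j * (ζ ^ i.val)⁻¹ ^ j.val := by
  have hpow : ∀ i : ZMod n, (ζ ^ i.val) ^ n = 1 := fun i => by
    rw [← pow_mul, mul_comm, pow_mul, hζ.pow_eq_one, one_pow]
  simp_rw [← sum_pow_val_mul_correlation a c (hpow _)]
  rw [Finset.sum_comm, eq_comm, Finset.sum_eq_single 0]
  · simp
  · intro s _ hs
    have hne : ζ ^ s.val ≠ 1 := fun h => hs <| by
      have := Nat.eq_zero_of_dvd_of_lt (hζ.dvd_of_pow_eq_one _ h) (ZMod.val_lt s)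
      rwa [ZMod.val_eq_zero] at this
    rw [← Finset.sum_mul]
    have := sum_pow_val_eq_zero (hpow s) hne
    simp_rw [← pow_mul, mul_comm s.val, pow_mul] at this
    rw [this, zero_mul]
  · simp

/-- The roots of `g`, their inverses and `1` are `n` different `n`-th roots of unity, hence all of
them. -/
theorem eq_one_or_eval_map_eq_zero {R : Type*} [CommRing R] [CharZero L] [IsAlgClosed L]
    {φ : R →+* L} (hφ : Function.Injective φ) {g : R[X]} (hg : g ∣ X ^ n - 1)
    (hgd : 2 * g.natDegree + 1 = n) (hg1 : g.eval 1 ≠ 0)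
    (hinv : ∀ z, (g.map φ).eval z = 0 → (g.map φ).eval z⁻¹ ≠ 0) {z : L} (hz : z ^ n = 1) :
    z = 1 ∨ (g.map φ).eval z = 0 ∨ (g.map φ).eval z⁻¹ = 0 := by
  classical
  let T := (g.map φ).roots.toFinset
  have hg0 : g.map φ ≠ 0 := (separable_map_of_dvd (NeZero.ne n) hg).ne_zero
  have hT : ∀ {y}, y ∈ T ↔ (g.map φ).eval y = 0 := fun {y} => by
    rw [Multiset.mem_toFinset, mem_roots hg0, IsRoot]
  have h1T : (1 : L) ∉ T := by
    rw [hT, ← map_one φ, eval_map_apply]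
    exact fun h => hg1 (hφ (h.trans (map_zero φ).symm))
  have hT' : ∀ {y}, y ∈ T.map (Equiv.inv L).toEmbedding ↔ (g.map φ).eval y⁻¹ = 0 := fun {y} => by
    rw [Finset.mem_map_equiv, hT]
    rfl
  have hdisj : Disjoint T (T.map (Equiv.inv L).toEmbedding) :=
    Finset.disjoint_left.2 fun y hy hy' => hinv y (hT.1 hy) (hT'.1 hy')
  have h1 : (1 : L) ∉ T ∪ T.map (Equiv.inv L).toEmbedding := by
    rw [Finset.mem_union, hT', inv_one, ← hT, or_self]
    exact h1T
  let U := insert (1 : L) (T ∪ T.map (Equiv.inv L).toEmbedding)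
  have hU : U.card = n := by
    rw [Finset.card_insert_of_notMem h1, Finset.card_union_of_disjoint hdisj, Finset.card_map,
      card_roots_map_toFinset hφ (NeZero.ne n) hg]
    omega
  have hsub : U ⊆ nthRootsFinset n (1 : L) := by
    intro y hy
    rw [mem_nthRootsFinset (NeZero.pos n)]
    rcases Finset.mem_insert.1 hy with rfl | hy
    · exact one_pow n
    rcases Finset.mem_union.1 hy with hy | hy
    · exact pow_eq_one_of_eval_map_eq_zero hg (hT.1 hy)
    · have := pow_eq_one_of_eval_map_eq_zero hg (hT'.1 hy)
      rwa [inv_pow, inv_eq_one] at this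
  have hzU : z ∈ U := by
    rw [Finset.eq_of_subset_of_card_le hsub, mem_nthRootsFinset (NeZero.pos n)]
    · exact hz
    · rw [hU]
      have : NeZero (n : L) := ⟨Nat.cast_ne_zero.2 (NeZero.ne n)⟩
      obtain ⟨ζ, hζ⟩ := HasEnoughRootsOfUnity.exists_primitiveRoot L n
      rw [hζ.card_nthRootsFinset]
  rcases Finset.mem_insert.1 hzU with h | h
  · exact Or.inl h
  · rw [Finset.mem_union, hT, hT'] at h
    exact Or.inr h

/-- The hypothesis `hinv` makes the inverses of the roots of `g`, together with `1`, exactly the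
`n`-th roots of unity at which `g` does not vanish. -/
theorem isSelfDual_extendedCode {R : Type*} [CommRing R] [IsDomain R] [CharZero L] [IsAlgClosed L]
    {φ : R →+* L} (hφ : Function.Injective φ) {g : R[X]} (hmon : g.Monic) (hg : g ∣ X ^ n - 1)
    (hgd : 2 * g.natDegree + 1 = n) (hg1 : g.eval 1 ≠ 0)
    (hinv : ∀ z, (g.map φ).eval z = 0 → (g.map φ).eval z⁻¹ ≠ 0) {θ : R} (hθ : n * θ ^ 2 = -1) :
    IsSelfDual (extendedCode n (cyclicCode n g) θ) := by
  have hn : IsUnit (n : R) := IsUnit.of_mul_eq_one (-θ ^ 2) (by linear_combination -hθ)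
  have hnL : (n : L) ≠ 0 := Nat.cast_ne_zero.2 (NeZero.ne n)
  have hgdeg : g.degree < n :=
    degree_le_natDegree.trans_lt (by exact_mod_cast (by omega : g.natDegree < n))
  have hmem := fun w => mem_extendedCode hn hg hgdeg hg1 (x := θ) (w := w)
  have hφ1 : ∀ f : R[X], (f.map φ).eval 1 = φ (f.eval 1) := fun f => by
    rw [← map_one φ, eval_map_apply]
  intro v
  constructor
  · intro hv w hw
    rw [hmem] at hv hw
    have : NeZero (n : L) := ⟨hnL⟩
    obtain ⟨ζ, hζ⟩ := HasEnoughRootsOfUnity.exists_primitiveRoot L n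
    have hpars := (card_mul_dotProduct hζ (fun j => φ (v (some j))) fun j => φ (w (some j))).symm
    simp_rw [← eval_map_wordPoly φ] at hpars
    -- a root of unity other than `1`, or its inverse, is a root of `g`
    rw [Finset.sum_eq_single 0] at hpars
    · rw [ZMod.val_zero, pow_zero, inv_one, hφ1, hφ1] at hpars
      simp_rw [← map_mul, ← map_sum] at hpars
      rw [← map_natCast φ, ← map_mul] at hpars
      have hR := hφ hpars
      rw [dotProduct, Fintype.sum_option, hv.2, hw.2]
      refine (mul_eq_zero.1 ?_).resolve_left hn.ne_zero
      linear_combination -hR + (wordPoly n fun j => v (some j)).eval 1 *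
        (wordPoly n fun j => w (some j)).eval 1 * hθ
    · intro i _ hi
      have hz : (ζ ^ i.val) ^ n = 1 := by
        rw [← pow_mul, mul_comm, pow_mul, hζ.pow_eq_one, one_pow]
      rcases eq_one_or_eval_map_eq_zero hφ hg hgd hg1 hinv hz with h | h | h
      · refine absurd ?_ hi
        have := Nat.eq_zero_of_dvd_of_lt (hζ.dvd_of_pow_eq_one _ h) (ZMod.val_lt i)
        rwa [ZMod.val_eq_zero] at this
      · rw [eval_eq_zero_of_dvd_of_eval_eq_zero (map_dvd φ hv.1) h, zero_mul]
      · rw [eval_eq_zero_of_dvd_of_eval_eq_zero (map_dvd φ hw.1) h, mul_zero]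
    · simp
  · intro hv
    let γ : ZMod n → R := fun j => g.coeff j.val
    have hγ : wordPoly n γ = g := eq_wordPoly_of_coeff hgdeg fun _ => rfl
    -- the words tested are the extended cyclic shifts of `g`
    have hshift : ∀ s : ZMod n,
        ∑ j, φ (v (some j)) * φ (γ (j - s)) + φ (v none * θ * g.eval 1) = 0 := by
      intro s
      have hs := dvd_wordPoly_shift_sub γ s
      rw [hγ] at hs
      have hs1 : (wordPoly n fun j => γ (j - s)).eval 1 = g.eval 1 := by
        have := eval_eq_zero_of_dvd_of_eval_eq_zero (x := 1) hs (by simp)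
        simpa [sub_eq_zero] using this
      have := hv (append (fun j => γ (j - s)) (θ * g.eval 1)) <| by
        rw [hmem]
        exact ⟨(dvd_sub_left (dvd_mul_left g _)).1 (hg.trans hs), by rw [← hs1]; rfl⟩
      rw [dotProduct, Fintype.sum_option] at this
      have h := congrArg φ this
      simp only [append, map_add, map_mul, map_sum, map_zero] at h ⊢
      linear_combination h
    have hcorr : ∀ z : L, z ^ n = 1 →
        ((wordPoly n fun j => v (some j)).map φ).eval z * (g.map φ).eval z⁻¹ +
          (∑ s : ZMod n, z ^ s.val) * φ (v none * θ * g.eval 1) = 0 := by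
      intro z hz
      conv_lhs => rw [← hγ]
      rw [eval_map_wordPoly, eval_map_wordPoly,
        ← sum_pow_val_mul_correlation _ (fun j => φ (γ j)) hz, Finset.sum_mul,
        ← Finset.sum_add_distrib]
      refine Finset.sum_eq_zero fun s _ => ?_
      rw [hγ, ← mul_add, hshift, mul_zero]
    rw [hmem]
    constructor
    · rw [← Polynomial.map_dvd_map φ hφ hmon]
      have hsep : (g.map φ).Separable := separable_map_of_dvd (NeZero.ne n) hg
      by_cases hv0 : (wordPoly n fun j => v (some j)).map φ = 0
      · rw [hv0]
        exact dvd_zero _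
      refine (IsAlgClosed.splits (g.map φ)).dvd_of_roots_le_roots hsep.ne_zero ?_
      rw [Multiset.le_iff_subset (nodup_roots hsep)]
      intro z hz
      have hgz : (g.map φ).eval z = 0 := (mem_roots hsep.ne_zero).1 hz
      have hzn := pow_eq_one_of_eval_map_eq_zero hg hgz
      have hz1 : z ≠ 1 := by
        rintro rfl
        rw [hφ1] at hgz
        exact hg1 (hφ (hgz.trans (map_zero φ).symm))
      have hc := hcorr z hzn
      rw [sum_pow_val_eq_zero hzn hz1, zero_mul, add_zero] at hc
      exact (mem_roots hv0).2 ((mul_eq_zero.1 hc).resolve_right (hinv z hgz))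
    · have h1 := hcorr 1 (one_pow n)
      rw [inv_one, hφ1, hφ1] at h1
      simp only [one_pow, Finset.sum_const, Finset.card_univ, ZMod.card, nsmul_eq_mul, mul_one] at h1
      rw [← map_natCast φ, ← map_mul, ← map_mul, ← map_add] at h1
      have h2 := hφ (h1.trans (map_zero φ).symm)
      have h3 : (wordPoly n fun j => v (some j)).eval 1 + n * v none * θ = 0 := by
        refine (mul_eq_zero.1 ?_).resolve_left hg1
        linear_combination h2
      linear_combination -θ * h3 + v none * hθ

end SelfDual

/-! ### Quadratic residues -/

section Residues

variable {n : ℕ} [Fact n.Prime]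

theorem neg_mem_residues_iff (hn : n % 4 = 3) {a : ZMod n} (ha : a ≠ 0) :
    -a ∈ residues n ↔ a ∉ residues n := by
  have h1 : quadraticChar (ZMod n) (-1) = -1 :=
    quadraticChar_neg_one_iff_not_isSquare.2 fun h => (ZMod.exists_sq_eq_neg_one_iff.1 h) hn
  simp only [residues, Finset.mem_filter, Finset.mem_univ, true_and, ne_eq, neg_eq_zero, ha,
    not_false_eq_true]
  rw [← quadraticChar_one_iff_isSquare (neg_ne_zero.2 ha), ← quadraticChar_neg_one_iff_not_isSquare,
    ← neg_one_mul, map_mul, h1, neg_one_mul, neg_eq_iff_eq_neg]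

theorem two_mul_card_residues_add_one (hn : n % 4 = 3) : 2 * (residues n).card + 1 = n := by
  classical
  have h0 : (0 : ZMod n) ∉ residues n := by simp [residues]
  have hdisj : Disjoint (residues n) ((residues n).map (Equiv.neg (ZMod n)).toEmbedding) := by
    rw [Finset.disjoint_left]
    intro a ha ha'
    rw [Finset.mem_map_equiv] at ha'
    exact (neg_mem_residues_iff hn fun h => h0 (h ▸ ha)).1 ha' ha
  have hunion : (residues n) ∪ ((residues n).map (Equiv.neg (ZMod n)).toEmbedding) =
      Finset.univ.erase 0 := by
    ext a
    rw [Finset.mem_union, Finset.mem_map_equiv, Finset.mem_erase]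
    change a ∈ residues n ∨ -a ∈ residues n ↔ _
    by_cases ha : a = 0
    · simp [ha, h0]
    · simp [neg_mem_residues_iff hn ha, ha, em]
  have hcard := congrArg Finset.card hunion
  rw [Finset.card_union_of_disjoint hdisj, Finset.card_map, Finset.card_erase_of_mem
    (Finset.mem_univ _), Finset.card_univ, ZMod.card] at hcard
  have := (Fact.out : n.Prime).pos
  omega

end Residues

/-! ### Generator polynomials of 2-adic quadratic residue codes -/

/-- Coprimality of monic polynomials lifts along local homomorphisms, since it means that their
resultant is a unit. -/
theorem isCoprime_of_isCoprime_map {R S : Type*} [CommRing R] [CommRing S] [Nontrivial S]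
    (φ : R →+* S) [IsLocalHom φ] {f g : R[X]} (hf : f.Monic) (hg : g.Monic)
    (h : IsCoprime (f.map φ) (g.map φ)) : IsCoprime f g := by
  rw [← isUnit_resultant_iff_isCoprime (hf.map φ), hf.natDegree_map, hg.natDegree_map,
    resultant_map_map] at h
  exact (isUnit_resultant_iff_isCoprime hf).1 (isUnit_of_map_unit φ _ h)

/-- Reduction modulo `2`, followed by the embedding into an algebraic closure, reflects units. -/
instance isLocalHom_toZMod : IsLocalHom
    ((algebraMap (ZMod 2) (AlgebraicClosure (ZMod 2))).comp (PadicInt.toZMod (p := 2))) where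
  map_nonunit a ha := by
    by_contra hu
    have hmem : a ∈ IsLocalRing.maximalIdeal ℤ_[2] := hu
    rw [← PadicInt.ker_toZMod, RingHom.mem_ker] at hmem
    rw [RingHom.comp_apply, hmem, map_zero] at ha
    exact not_isUnit_zero ha

section Generator

variable {n : ℕ} [Fact n.Prime] {g : ℤ_[2][X]}

theorem IsQRGenerator.natDegree (hn : n % 4 = 3) (hg : IsQRGenerator n g) :
    2 * g.natDegree + 1 = n := by
  obtain ⟨hmon, -, α, -, hmap⟩ := hg
  rw [← hmon.natDegree_map
    ((algebraMap (ZMod 2) (AlgebraicClosure (ZMod 2))).comp PadicInt.toZMod), hmap,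
    natDegree_prod_of_monic _ _ fun r _ => monic_X_sub_C _]
  simpa only [natDegree_X_sub_C, Finset.sum_const, smul_eq_mul, mul_one] using
    two_mul_card_residues_add_one hn

theorem IsQRGenerator.eval_one_ne_zero (hg : IsQRGenerator n g) : g.eval 1 ≠ 0 := by
  obtain ⟨-, -, α, hα, hmap⟩ := hg
  intro h
  have h1 := congrArg (eval 1) hmap
  rw [← map_one ((algebraMap (ZMod 2) (AlgebraicClosure (ZMod 2))).comp PadicInt.toZMod),
    eval_map_apply, h, map_zero, map_one, eval_prod, eq_comm, Finset.prod_eq_zero_iff] at h1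
  obtain ⟨r, hr, hr1⟩ := h1
  rw [eval_sub, eval_X, eval_C, sub_eq_zero, eq_comm] at hr1
  have := Nat.eq_zero_of_dvd_of_lt (hα.dvd_of_pow_eq_one _ hr1) (ZMod.val_lt r)
  rw [ZMod.val_eq_zero] at this
  simp [residues, this] at hr

/-- No root of `g` is the inverse of a root, because `-1` is not a quadratic residue. Inversion of
`n`-th roots of unity is written as the power `n - 1`, so that the inverses of the roots of `g` are
the roots of the monic polynomial `g(X ^ (n - 1))`, to which coprimality lifts from `𝔽₂`. -/
theorem IsQRGenerator.isCoprime_expand (hn : n % 4 = 3) (hg : IsQRGenerator n g) :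
    IsCoprime g (expand ℤ_[2] (n - 1) g) := by
  have hpos : 0 < n - 1 := by omega
  obtain ⟨hmon, -, α, hα, hmap⟩ := hg
  refine isCoprime_of_isCoprime_map
    ((algebraMap (ZMod 2) (AlgebraicClosure (ZMod 2))).comp PadicInt.toZMod) hmon
    (hmon.expand hpos) ?_
  rw [map_expand, hmap]
  refine IsCoprime.prod_left fun r hr => ?_
  rw [(irreducible_X_sub_C _).coprime_iff_not_dvd, dvd_iff_isRoot, IsRoot, expand_eval, eval_prod,
    Finset.prod_eq_zero_iff]
  rintro ⟨s, hs, h⟩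
  rw [eval_sub, eval_X, eval_C, sub_eq_zero] at h
  have hr0 : r ≠ 0 := by rintro rfl; simp [residues] at hr
  have hpow : α ^ (s + r).val = 1 := by
    rw [pow_val_add hα.pow_eq_one, ← h, ← pow_succ, Nat.sub_add_cancel (by omega), ← pow_mul,
      mul_comm, pow_mul, hα.pow_eq_one, one_pow]
  have := Nat.eq_zero_of_dvd_of_lt (hα.dvd_of_pow_eq_one _ hpow) (ZMod.val_lt _)
  rw [ZMod.val_eq_zero, add_eq_zero_iff_eq_neg] at this
  exact (neg_mem_residues_iff hn hr0).1 (this ▸ hs) hr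

theorem IsQRGenerator.eval_inv_ne_zero {L : Type*} [Field L] (φ : ℤ_[2] →+* L) (hn : n % 4 = 3)
    (hg : IsQRGenerator n g) {z : L} (hz : (g.map φ).eval z = 0) : (g.map φ).eval z⁻¹ ≠ 0 := by
  intro hz'
  have hzn := pow_eq_one_of_eval_map_eq_zero hg.2.1 hz
  have hinv : z ^ (n - 1) = z⁻¹ := by
    rw [← mul_eq_one_iff_eq_inv₀ (by rintro rfl; simp [zero_pow (NeZero.ne n)] at hzn), ← pow_succ,
      Nat.sub_add_cancel (by omega), hzn]
  obtain ⟨a, b, hab⟩ := hg.isCoprime_expand hn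
  have := congrArg (fun f => (f.map φ).eval z) hab
  simp [map_expand, expand_eval, hinv, hz, hz'] at this

end Generator

/-! ### Codes given by shifts of a vector -/

section Shift

variable {R : Type*} [CommRing R] {k : ℕ}

/-- The polynomial with coefficients `a₀, …, aₖ₋₁`, lowest degree first. -/
def vectorPoly (a : Fin k → R) : R[X] :=
  ∑ i : Fin k, C (a i) * X ^ (i : ℕ)

theorem coeff_vectorPoly (a : Fin k → R) (m : ℕ) :
    (vectorPoly a).coeff m = if h : m < k then a ⟨m, h⟩ else 0 := by
  simp only [vectorPoly, finsetSum_coeff, coeff_C_mul_X_pow]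
  split_ifs with h
  · rw [Finset.sum_eq_single ⟨m, h⟩]
    · simp
    · intro i _ hi
      exact if_neg fun hm => hi (Fin.ext hm.symm)
    · simp
  · exact Finset.sum_eq_zero fun i _ => if_neg fun (hm : m = i) => h (hm ▸ i.2)

theorem shiftCode_eq_map_encode (a : Fin k → R) :
    shiftCode a = (degreeLT R k).map (encode (vectorPoly a) 1 Fin.val) := by
  classical
  have hrow : ∀ i : Fin k, (shiftMatrix a).row i = encode (vectorPoly a) 1 Fin.val (X ^ (i : ℕ)) := by
    intro i
    funext j
    cases j with
    | none => simp [shiftMatrix, append]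
    | some j =>
      simp only [shiftMatrix, Matrix.row, Matrix.of_apply, append, encode_some, coeff_X_pow_mul',
        coeff_vectorPoly]
      by_cases h1 : (i : ℕ) ≤ j <;> by_cases h2 : (j : ℕ) - i < k <;> simp [h1, h2]
  rw [degreeLT_eq_span_X_pow, Submodule.map_span, shiftCode]
  congr 1
  ext w
  simp only [Set.mem_range, Finset.coe_image, Finset.coe_range, Set.mem_image, Set.mem_Iio,
    exists_exists_and_eq_and]
  exact ⟨fun ⟨i, hi⟩ => ⟨i, i.2, hi ▸ (hrow i).symm⟩, fun ⟨i, hi, h⟩ => ⟨⟨i, hi⟩, h ▸ hrow ⟨i, hi⟩⟩⟩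

theorem shiftCode_properties [IsDomain R] [CharZero R] [Fact (2 * k - 1).Prime] {a : Fin k → R}
    (hdvd : vectorPoly a ∣ X ^ (2 * k - 1) - 1) (hdeg : (vectorPoly a).coeff (k - 1) ≠ 0)
    (h1 : (vectorPoly a).eval 1 ≠ 0) :
    IsMinHammingDist (shiftCode a) (k + 1) ∧ IsMDS (shiftCode a) ∧
      ColumnsIndependent (shiftCode a) := by
  have hk : 2 * k - 1 ≠ 0 := (Fact.out : (2 * k - 1).Prime).ne_zero
  have hn : 2 * k - 1 + 1 = 2 * k := by omega
  have hgd : (vectorPoly a).natDegree + 1 = k := by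
    have hle := le_natDegree_of_ne_zero hdeg
    have : (vectorPoly a).natDegree ≤ k - 1 := natDegree_le_iff_coeff_eq_zero.2 fun m hm => by
      rw [coeff_vectorPoly, dif_neg (by omega)]
    omega
  have hr : Set.range (Fin.val : Fin (2 * k - 1) → ℕ) = Set.Iio (2 * k - 1) := Fin.range_val
  rw [shiftCode_eq_map_encode]
  have hmds := isMDS_encode hn hdvd hgd h1 one_ne_zero Fin.val_injective hr
  exact ⟨isMinHammingDist_encode hn hdvd hgd h1 one_ne_zero Fin.val_injective hr, hmds,
    columnsIndependent_of_isMDS hmds⟩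

end Shift

/-! ### The 2-adic Hamming and Golay codes -/

/-- Hensel's lemma at `0`, where the polynomial is even and its derivative is a unit. -/
theorem exists_padicInt_root (a : ℤ_[2]) (ha : 2 ∣ a) : ∃ z : ℤ_[2], z ^ 2 - z + a = 0 := by
  obtain ⟨b, rfl⟩ := ha
  have hnorm : ‖(X ^ 2 - X + C (2 * b) : ℤ_[2][X]).aeval (0 : ℤ_[2])‖ <
      ‖(derivative (X ^ 2 - X + C (2 * b) : ℤ_[2][X])).aeval (0 : ℤ_[2])‖ ^ 2 := by
    have h2 : ‖(2 * b : ℤ_[2])‖ < 1 :=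
      (PadicInt.norm_lt_one_iff_dvd _).2 (by simp)
    simpa using h2
  obtain ⟨z, hz, -⟩ := hensels_lemma hnorm
  exact ⟨z, by simpa using hz⟩

theorem hammingCode_properties {l : ℤ_[2]} (hl : l ^ 2 - l + 2 = 0) :
    IsMinHammingDist (hammingCode l) 5 ∧ IsMDS (hammingCode l) ∧
      ColumnsIndependent (hammingCode l) := by
  have : Fact (2 * 4 - 1).Prime := ⟨by norm_num⟩
  have hC : (C l ^ 2 - C l + 2 : ℤ_[2][X]) = 0 := by
    simpa [map_ofNat (C : ℤ_[2] →+* ℤ_[2][X])] using congrArg C hl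
  have hpoly : vectorPoly ![1, l, l - 1, -1] =
      (1 + C l * X + (C l - 1) * X ^ 2 - X ^ 3 : ℤ_[2][X]) := by
    simp [vectorPoly, Fin.sum_univ_succ]
    ring
  refine shiftCode_properties ?_ ?_ ?_
  -- the cofactor is `X - 1` times the polynomial of the conjugate root `1 - l`
  · refine ⟨(X - 1) * (1 + (1 - C l) * X - C l * X ^ 2 - X ^ 3), ?_⟩
    rw [hpoly]
    linear_combination (-X ^ 2 - X ^ 3 + X ^ 4 + X ^ 5) * hC
  · simp [coeff_vectorPoly]
  · rw [hpoly]
    intro h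
    simp at h
    -- `2 * l - 1` is the value at `1`, and its square is `-7`
    have h7 : (7 : ℤ_[2]) = 0 := by linear_combination 4 * hl - (2 * l - 1) * h
    exact absurd h7 (by norm_num)

theorem golayCode_properties {v : ℤ_[2]} (hv : v ^ 2 - v + 6 = 0) :
    IsMinHammingDist (golayCode v) 13 ∧ IsMDS (golayCode v) ∧
      ColumnsIndependent (golayCode v) := by
  have : Fact (2 * 12 - 1).Prime := ⟨by norm_num⟩
  have hC : (C v ^ 2 - C v + 6 : ℤ_[2][X]) = 0 := by
    simpa [map_ofNat (C : ℤ_[2] →+* ℤ_[2][X])] using congrArg C hv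
  have hpoly : vectorPoly ![1, v, v - 3, -4, -(v + 3), -(2 * v + 1), -(2 * v - 3), -(v - 4), 4,
      v + 2, v - 1, -1] =
      (1 + C v * X + (C v - 3) * X ^ 2 - 4 * X ^ 3 - (C v + 3) * X ^ 4 - (2 * C v + 1) * X ^ 5
        - (2 * C v - 3) * X ^ 6 - (C v - 4) * X ^ 7 + 4 * X ^ 8 + (C v + 2) * X ^ 9
        + (C v - 1) * X ^ 10 - X ^ 11 : ℤ_[2][X]) := by
    simp [vectorPoly, Fin.sum_univ_succ, map_ofNat (C : ℤ_[2] →+* ℤ_[2][X])]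
    ring
  refine shiftCode_properties ?_ ?_ ?_
  -- the cofactor is `X - 1` times the polynomial of the conjugate root `1 - v`
  · refine ⟨(X - 1) * (1 + (1 - C v) * X - (C v + 2) * X ^ 2 - 4 * X ^ 3 + (C v - 4) * X ^ 4
      + (2 * C v - 3) * X ^ 5 + (2 * C v + 1) * X ^ 6 + (C v + 3) * X ^ 7 + 4 * X ^ 8
      + (3 - C v) * X ^ 9 - C v * X ^ 10 - X ^ 11), ?_⟩
    rw [hpoly]
    linear_combination (-X ^ 2 - X ^ 3 + X ^ 4 + 3 * X ^ 5 + 4 * X ^ 6 + 2 * X ^ 7 - 3 * X ^ 8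
      - 7 * X ^ 9 - 8 * X ^ 10 - 4 * X ^ 11 + 4 * X ^ 12 + 8 * X ^ 13 + 7 * X ^ 14 + 3 * X ^ 15
      - 2 * X ^ 16 - 4 * X ^ 17 - 3 * X ^ 18 - X ^ 19 + X ^ 20 + X ^ 21) * hC
  · simp [coeff_vectorPoly]
  · rw [hpoly]
    intro h
    simp at h
    -- `1 - 2 * v` is the value at `1`, and its square is `-23`
    have h23 : (23 : ℤ_[2]) = 0 := by linear_combination 4 * hv - (2 * v - 1) * (-h)
    exact absurd h23 (by norm_num)

end AdicCode

end

theorem theorem8 :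
    (∀ (n m : ℕ) [Fact n.Prime], n + 1 = 8 * m →
      ∀ g : ℤ_[2][X], AdicCode.IsQRGenerator n g →
      ∀ θ : ℤ_[2], (n : ℤ_[2]) * θ ^ 2 = -1 →
        AdicCode.IsSelfDual (AdicCode.extendedCode n (AdicCode.cyclicCode n g) θ) ∧
        AdicCode.IsMinHammingDist (AdicCode.extendedCode n (AdicCode.cyclicCode n g) θ)
          ((n + 3) / 2) ∧
        AdicCode.IsMDS (AdicCode.extendedCode n (AdicCode.cyclicCode n g) θ) ∧
        AdicCode.ColumnsIndependent (AdicCode.extendedCode n (AdicCode.cyclicCode n g) θ)) ∧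
    ((∃ l : ℤ_[2], l ^ 2 - l + 2 = 0) ∧
      ∀ l : ℤ_[2], l ^ 2 - l + 2 = 0 →
        AdicCode.IsMinHammingDist (AdicCode.hammingCode l) 5 ∧
        AdicCode.IsMDS (AdicCode.hammingCode l) ∧
        AdicCode.ColumnsIndependent (AdicCode.hammingCode l)) ∧
    ((∃ v : ℤ_[2], v ^ 2 - v + 6 = 0) ∧
      ∀ v : ℤ_[2], v ^ 2 - v + 6 = 0 →
        AdicCode.IsMinHammingDist (AdicCode.golayCode v) 13 ∧
        AdicCode.IsMDS (AdicCode.golayCode v) ∧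
        AdicCode.ColumnsIndependent (AdicCode.golayCode v)) := by
  refine ⟨?_, ⟨AdicCode.exists_padicInt_root 2 dvd_rfl, fun l => AdicCode.hammingCode_properties⟩,
    ⟨AdicCode.exists_padicInt_root 6 ⟨3, by norm_num⟩, fun v => AdicCode.golayCode_properties⟩⟩
  intro n m _ hm g hg θ hθ
  have hn : n % 4 = 3 := by omega
  have hgd := hg.natDegree hn
  have hg1 := hg.eval_one_ne_zero
  have hnu : IsUnit (n : ℤ_[2]) := IsUnit.of_mul_eq_one (-θ ^ 2) (by linear_combination -hθ)
  have hθ0 : θ ≠ 0 := by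
    rintro rfl
    simp at hθ
  have hk : n + 1 = 2 * (g.natDegree + 1) := by omega
  have hr : Set.range (ZMod.val : ZMod n → ℕ) = Set.Iio n := by
    ext i
    exact ⟨fun ⟨j, hj⟩ => hj ▸ ZMod.val_lt j, fun hi => ⟨i, ZMod.val_cast_of_lt hi⟩⟩
  have hx : θ * g.eval 1 ≠ 0 := mul_ne_zero hθ0 hg1
  have hcode := AdicCode.extendedCode_eq_map_encode hnu hg.2.1 hk rfl hg1 θ
  have hmds := AdicCode.isMDS_encode hk hg.2.1 rfl hg1 hx (ZMod.val_injective n) hr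
  rw [← hcode] at hmds
  refine ⟨?_, ?_, hmds, AdicCode.columnsIndependent_of_isMDS hmds⟩
  · let φ : ℤ_[2] →+* AlgebraicClosure ℚ_[2] :=
      (algebraMap ℚ_[2] (AlgebraicClosure ℚ_[2])).comp (algebraMap ℤ_[2] ℚ_[2])
    have hφ : Function.Injective φ := (algebraMap ℚ_[2] (AlgebraicClosure ℚ_[2])).injective.comp
      (IsFractionRing.injective ℤ_[2] ℚ_[2])
    have : CharZero (AlgebraicClosure ℚ_[2]) := charZero_of_injective_ringHom hφ
    exact AdicCode.isSelfDual_extendedCode hφ hg.1 hg.2.1 hgd hg1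
      (fun z hz => hg.eval_inv_ne_zero φ hn hz) hθ
  · have hd := AdicCode.isMinHammingDist_encode hk hg.2.1 rfl hg1 hx (ZMod.val_injective n) hr
    rw [← hcode] at hd
    rwa [show (n + 3) / 2 = g.natDegree + 1 + 1 by omega]
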